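/- Let $n\ge 0$ be an integer and, for $q\in[1,\infty]$, let $q'$ be the conjugate exponent. The Fourier transform is $\widehat f(y)=\int_{\mathbb R^n} f(x)e^{-2\pi i x\cdot y}\,dx$ for Schwartz functions, and in general it is understood in the sense of tempered distributions: $\langle \widehat f,\psi\rangle=\int f\,\widehat\psi\,dx$ for all Schwartz functions $\psi$. For $q\in[1,\infty]$ let $\widehat L^q=\{f\in L^q(\mathbb R^n): f=\widehat g \text{ for some } g\in L^{q'}(\mathbb R^n)\}$, with the norm $\|f\|_{\widehat L^q}=\|\widehat f\,\|_{q'}$. Since these functions are integrated against measures that may charge Lebesgue null sets, the elements of $\widehat L^q$ are Borel functions, not classes of functions: fix an arbitrary set $S\subset\mathbb R^n$; for $q=\infty$ the elements are the continuous functions $\widehat g$, $g\in L^1$, and for $q<\infty$ they are the Borel representatives that are continuous at every point of $S$ (all Borel representatives if $S=\emptyset$, the continuous ones if $S=\mathbb R^n$). Let $\mathcal M$ be the set of complex-valued $\sigma$-finite Borel measures on $\mathbb R^n$, that is, $d\mu=\theta\,d|\mu|$ with $|\mu|$ a positive $\sigma$-finite Borel measure and $\theta$ a Borel function with $|\theta|=1$.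 For $\mu\in\mathcal M$ and a Borel function $f:\mathbb R^n\to\mathbb C$, the measure $f\mu\in\mathcal M$ is given by $d(f\mu)=f\theta\,d|\mu|$, so that $(f\mu)(F)=\int_F f\,d\mu$ whenever $f$ is $|\mu|$-integrable on $F$. For $p\in[1,\infty]$ let $$\|\mu\|_p^*=\sup\Big\{\Big|\int_{\mathbb R^n}h\,d\mu\Big| : h\in\widehat L^{p'},\ \|h\|_{\widehat L^{p'}}\le 1\Big\}\in[0,\infty],$$ where $|\int h\,d\mu|$ is read as $\infty$ if $h$ is not $|\mu|$-integrable, and let $\mathcal M_p=\{\mu\in\mathcal M:\|\mu\|_p^*<\infty\}$. **Theorem.** Let $S\subset\mathbb R^n$ be any set and let $p,q,r\in[1,\infty]$ with $\frac1r=\frac1q+\frac1p$. If $\mu\in\mathcal M_p$ and $f\in\widehat L^q$, then $$\|f\mu\|_r^*\le\|f\|_{\widehat L^q}\,\|\mu\|_p^*.$$ -/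

import Mathlib

open MeasureTheory
open scoped ENNReal FourierTransform SchwartzMap

noncomputable section

namespace MeasureLp

/-- A (complex, not necessarily finite) sigma-finite Borel measure `μ` on `ℝⁿ`, given by its polar
decomposition `dμ = phase d|μ|`: the total variation `|μ|` is a positive sigma-finite Borel
measure and `phase` is a Borel function of modulus one. -/
structure SigmaFiniteComplexMeasure (n : ℕ) where
  /-- the total variation measure `|μ|` -/
  variation : Measure (EuclideanSpace ℝ (Fin n))
  sigmaFinite : SigmaFinite variation
  /-- the density of `μ` with respect to `|μ|` -/
  phase : EuclideanSpace ℝ (Fin n) → ℂ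
  measurable_phase : Measurable phase
  norm_phase : ∀ x, ‖phase x‖ = 1

namespace SigmaFiniteComplexMeasure

variable {n : ℕ}

/-- `∫_F h dμ` exists (absolutely) for every Borel set `F`. -/
def Integrable (μ : SigmaFiniteComplexMeasure n) (h : EuclideanSpace ℝ (Fin n) → ℂ) : Prop :=
  MeasureTheory.Integrable h μ.variation

/-- `∫_F h dμ`. -/
def setIntegral (μ : SigmaFiniteComplexMeasure n) (F : Set (EuclideanSpace ℝ (Fin n)))
    (h : EuclideanSpace ℝ (Fin n) → ℂ) : ℂ :=
  ∫ x in F, h x * μ.phase x ∂μ.variation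

/-- `∫ h dμ` over the whole space. -/
def integral (μ : SigmaFiniteComplexMeasure n) (h : EuclideanSpace ℝ (Fin n) → ℂ) : ℂ :=
  ∫ x, h x * μ.phase x ∂μ.variation

/-- The product `f μ` of a measure with a Borel function `f`, that is `(f μ)(F) = ∫_F f dμ`
(see `setIntegral_mulFun`): its variation is `|f| d|μ|` and its phase is that of `f` times that
of `μ`. -/
def mulFun (μ : SigmaFiniteComplexMeasure n) (f : EuclideanSpace ℝ (Fin n) → ℂ)
    (hf : Measurable f) : SigmaFiniteComplexMeasure n where
  variation := μ.variation.withDensity fun x => (‖f x‖₊ : ℝ≥0∞)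
  sigmaFinite := by
    have := μ.sigmaFinite
    exact SigmaFinite.withDensity fun x => ‖f x‖₊
  phase := fun x => (if f x = 0 then 1 else f x / (‖f x‖ : ℂ)) * μ.phase x
  measurable_phase := by
    refine Measurable.mul (Measurable.ite (hf (measurableSet_singleton 0)) measurable_const
      (hf.div ?_)) μ.measurable_phase
    exact Complex.measurable_ofReal.comp hf.norm
  norm_phase := by
    intro x
    by_cases h : f x = 0
    · simp [h, μ.norm_phase x]
    · simp [h, μ.norm_phase x]

/-- `f μ` has the defining property of the product of a measure with a function. -/
theorem setIntegral_mulFun (μ : SigmaFiniteComplexMeasure n)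
    (f : EuclideanSpace ℝ (Fin n) → ℂ) (hf : Measurable f)
    (F : Set (EuclideanSpace ℝ (Fin n))) (hF : MeasurableSet F) :
    (μ.mulFun f hf).setIntegral F (fun _ => 1) = μ.setIntegral F f := by
  unfold setIntegral mulFun
  simp only
  rw [setIntegral_withDensity_eq_setIntegral_smul hf.nnnorm _ hF]
  refine integral_congr_ae (Filter.Eventually.of_forall fun x => ?_)
  by_cases h : f x = 0
  · simp [h]
  · have h' : (‖f x‖ : ℂ) ≠ 0 := by simpa using h
    simp only [h, if_false, NNReal.smul_def, coe_nnnorm, Complex.real_smul, one_mul]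
    field_simp

end SigmaFiniteComplexMeasure

variable {n : ℕ}

/-- `f = ĝ` in the sense of tempered distributions: `⟨f, φ⟩ = ∫ g φ̂` for all Schwartz `φ`, with
`φ̂(y) = ∫ φ(x) exp(-2πi x·y) dx`. -/
def IsFourierTransformOf (f g : EuclideanSpace ℝ (Fin n) → ℂ) : Prop :=
  ∀ φ : 𝓢(EuclideanSpace ℝ (Fin n), ℂ), ∫ x, f x * φ x = ∫ x, g x * (𝓕 φ) x

/-- The space `L̂^q(ℝⁿ)`: the functions `f ∈ L^q` with `f = ĝ` for some `g ∈ L^{q'}`.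

Its elements are to be integrated against measures that may charge Lebesgue null sets, so they are
genuine Borel functions here, not classes modulo Lebesgue null sets. For `q = ∞` the function is
the (continuous) function `y ↦ ∫ g(x) exp(-2πi x·y) dx`. For `q < ∞` the representatives that are
used are those that are continuous at each point of a set `S`: all of them if `S = ∅`, the
continuous ones if `S` is the whole space. -/
structure MemHatL (S : Set (EuclideanSpace ℝ (Fin n))) (q : ℝ≥0∞)
    (f : EuclideanSpace ℝ (Fin n) → ℂ) : Prop where
  measurable : Measurable f
  memLp : MemLp f q volume
  exists_fourier : ∃ g : EuclideanSpace ℝ (Fin n) → ℂ,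
    MemLp g (ENNReal.conjExponent q) volume ∧ IsFourierTransformOf f g
  continuousAt : ∀ x, x ∈ S ∨ q = ∞ → ContinuousAt f x

/-- `‖f‖_{L̂^q} = ‖f̂‖_{q'}`. The infimum runs over the representatives `g` of the class `f̂`, all of
which have the same norm; it is `∞` if `f̂` is not in `L^{q'}`. -/
def hatNorm (q : ℝ≥0∞) (f : EuclideanSpace ℝ (Fin n) → ℂ) : ℝ≥0∞ :=
  ⨅ (g : EuclideanSpace ℝ (Fin n) → ℂ)
    (_ : MemLp g (ENNReal.conjExponent q) volume ∧ IsFourierTransformOf g f),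
    eLpNorm g (ENNReal.conjExponent q) volume

open Classical in
/-- `‖μ‖_p^* = sup { |∫ h dμ| : h ∈ L̂^{p'}, ‖h‖_{L̂^{p'}} ≤ 1 }`, with the value `∞` if one of
these integrals does not exist. -/
def starNorm (S : Set (EuclideanSpace ℝ (Fin n))) (p : ℝ≥0∞)
    (μ : SigmaFiniteComplexMeasure n) : ℝ≥0∞ :=
  ⨆ (h : EuclideanSpace ℝ (Fin n) → ℂ)
    (_ : MemHatL S (ENNReal.conjExponent p) h ∧ hatNorm (ENNReal.conjExponent p) h ≤ 1),
    if μ.Integrable h then ‖μ.integral h‖ₑ else ∞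

/-- The space `M_p` of the measures with `‖μ‖_p^* < ∞`. -/
def spaceM (S : Set (EuclideanSpace ℝ (Fin n))) (p : ℝ≥0∞) :
    Set (SigmaFiniteComplexMeasure n) :=
  {μ | starNorm S p μ < ∞}

end MeasureLp

end

/-! By duality the bound is a statement about products of test functions. Pairing `fμ` with `h ∈
L̂^{r'}` is pairing `μ` with `hf`, so it is enough that `hf ∈ L̂^{p'}` with norm at most `‖f‖ ‖h‖`;
the definition of `‖μ‖_p^*`, extended by homogeneity, does the rest
(`MemHatL.integrable_and_enorm_integral_le`).

Hölder puts `hf` in `L^{p'}`, as `1/r' + 1/q = 1/p'`. Its Fourier transform should be `k * g` with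
`k = ĥ ∈ L^r` and `g = f̂ ∈ L^{q'}`, and Young's inequality (`1/q' + 1/r = 1 + 1/p`) bounds this in
`L^p`, the conjugate of `L^{p'}`.

The real work is the identity `(hf)^ = k * g` when transforms exist only as distributions
(`IsFourierTransformOf.convolution_mul`). Inserting the inverse transform of an approximate identity
makes `k` integrable, so that Fubini applies. The factor is removed by dominated convergence on one
side and by continuity of translation in the pairing of `L^r` with `L^{r'}` on the other. -/

noncomputable section

namespace MeasureLp

/-! ### Young's convolution inequality. -/

section Young

variable {G : Type*} [AddCommGroup G] [MeasurableSpace G] [MeasurableAdd₂ G] [MeasurableNeg G]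
  {μ : Measure G} [μ.IsAddLeftInvariant]
  {𝕜 : Type*} [NormedField 𝕜]

theorem lintegral_enorm_mul_sub_le_of_holderConjugate {k g : G → 𝕜} {a b : ℝ≥0∞}
    [μ.IsNegInvariant] [ENNReal.HolderConjugate b a] (hk : AEStronglyMeasurable k μ) (hg : AEStronglyMeasurable g μ)
    (x : G) :
    ∫⁻ t, ‖k t‖ₑ * ‖g (x - t)‖ₑ ∂μ ≤ eLpNorm k b μ * eLpNorm g a μ := by
  have hmp := Measure.measurePreserving_sub_left μ x
  have h := eLpNorm_smul_le_mul_eLpNorm (p := b) (q := a) (r := 1)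
    (hg.comp_measurePreserving hmp) hk
  rw [eLpNorm_comp_measurePreserving hg hmp, eLpNorm_one_eq_lintegral_enorm] at h
  simpa [enorm_mul] using h

theorem aemeasurable_prod_enorm_mul_sub [SFinite μ] {k g : G → 𝕜}
    (hk : AEStronglyMeasurable k μ) (hg : AEStronglyMeasurable g μ) (α β : ℝ) :
    AEMeasurable (fun z : G × G => ‖k z.2‖ₑ ^ β * ‖g (z.1 - z.2)‖ₑ ^ α) (μ.prod μ) :=
  (hk.comp_snd.enorm.pow_const β).mul
    (((hg.mono_ac (quasiMeasurePreserving_sub_of_right_invariant μ μ).absolutelyContinuous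
      ).comp_measurable measurable_sub).enorm.pow_const α)

variable [μ.IsNegInvariant]

/-- Three-factor Hölder with weights `1/γ`, `1/β - 1/γ`, `1/α - 1/γ`, which sum to 1 by `h`. Only
the first factor depends on `x`, so the `γ`-th power can then be integrated by Tonelli. -/
theorem lintegral_enorm_mul_sub_le_rpow {k g : G → 𝕜} {α β γ : ℝ}
    (hα : 0 < α) (hβ : 0 < β) (hγ : 0 < γ) (hαγ : α ≤ γ) (hβγ : β ≤ γ)
    (h : α⁻¹ + β⁻¹ = 1 + γ⁻¹)
    (hk : AEStronglyMeasurable k μ) (hg : AEStronglyMeasurable g μ) (x : G) :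
    ∫⁻ t, ‖k t‖ₑ * ‖g (x - t)‖ₑ ∂μ ≤
      (∫⁻ t, ‖k t‖ₑ ^ β * ‖g (x - t)‖ₑ ^ α ∂μ) ^ γ⁻¹ *
        ((∫⁻ t, ‖k t‖ₑ ^ β ∂μ) ^ (β⁻¹ - γ⁻¹) * (∫⁻ t, ‖g t‖ₑ ^ α ∂μ) ^ (α⁻¹ - γ⁻¹)) := by
  have hmp := Measure.measurePreserving_sub_left μ x
  have hgx : AEMeasurable (fun t => ‖g (x - t)‖ₑ) μ := (hg.comp_measurePreserving hmp).enorm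
  have hβ' : 0 ≤ β⁻¹ - γ⁻¹ := sub_nonneg.2 (inv_anti₀ hβ hβγ)
  have hα' : 0 ≤ α⁻¹ - γ⁻¹ := sub_nonneg.2 (inv_anti₀ hα hαγ)
  have key := ENNReal.lintegral_prod_norm_pow_le (μ := μ) (Finset.univ : Finset (Fin 3))
    (f := ![fun t => ‖k t‖ₑ ^ β * ‖g (x - t)‖ₑ ^ α, fun t => ‖k t‖ₑ ^ β,
      fun t => ‖g (x - t)‖ₑ ^ α])
    (p := ![γ⁻¹, β⁻¹ - γ⁻¹, α⁻¹ - γ⁻¹])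
    (by
      intro i _
      fin_cases i
      · exact (hk.enorm.pow_const β).mul (hgx.pow_const α)
      · exact hk.enorm.pow_const β
      · exact hgx.pow_const α)
    (by simp [Fin.sum_univ_three]; linarith)
    (by
      intro i _
      fin_cases i
      · simpa using hγ.le
      · exact hβ'
      · exact hα')
  simp only [Fin.prod_univ_three, Matrix.cons_val_zero, Matrix.cons_val_one,
    Matrix.cons_val] at key
  rw [lintegral_sub_left_eq_self (fun t => ‖g t‖ₑ ^ α) x, mul_assoc] at key
  refine le_trans (le_of_eq (lintegral_congr fun t => ?_)) key
  rw [ENNReal.mul_rpow_of_nonneg _ _ (inv_nonneg.2 hγ.le)]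
  simp only [← ENNReal.rpow_mul]
  -- Both exponents are nonnegative, so the splitting also holds at the values `0` and `∞`.
  have e1 : ‖k t‖ₑ = ‖k t‖ₑ ^ (β * γ⁻¹) * ‖k t‖ₑ ^ (β * (β⁻¹ - γ⁻¹)) := by
    rw [← ENNReal.rpow_add_of_nonneg _ _ (by positivity) (by positivity), ← mul_add,
      add_sub_cancel, mul_inv_cancel₀ hβ.ne', ENNReal.rpow_one]
  have e2 : ‖g (x - t)‖ₑ =
      ‖g (x - t)‖ₑ ^ (α * γ⁻¹) * ‖g (x - t)‖ₑ ^ (α * (α⁻¹ - γ⁻¹)) := by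
    rw [← ENNReal.rpow_add_of_nonneg _ _ (by positivity) (by positivity), ← mul_add,
      add_sub_cancel, mul_inv_cancel₀ hα.ne', ENNReal.rpow_one]
  calc ‖k t‖ₑ * ‖g (x - t)‖ₑ = _ := congrArg₂ (· * ·) e1 e2
    _ = _ := by ring

/-- **Young's convolution inequality** for finite exponents. -/
theorem lintegral_rpow_lintegral_enorm_mul_sub_le [SFinite μ] {k g : G → 𝕜} {α β γ : ℝ}
    (hα : 0 < α) (hβ : 0 < β) (hγ : 0 < γ) (hαγ : α ≤ γ) (hβγ : β ≤ γ)
    (h : α⁻¹ + β⁻¹ = 1 + γ⁻¹)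
    (hk : AEStronglyMeasurable k μ) (hg : AEStronglyMeasurable g μ) :
    ∫⁻ x, (∫⁻ t, ‖k t‖ₑ * ‖g (x - t)‖ₑ ∂μ) ^ γ ∂μ ≤
      ((∫⁻ t, ‖k t‖ₑ ^ β ∂μ) ^ β⁻¹ * (∫⁻ t, ‖g t‖ₑ ^ α ∂μ) ^ α⁻¹) ^ γ := by
  set A := ∫⁻ t, ‖k t‖ₑ ^ β ∂μ with hA
  set B := ∫⁻ t, ‖g t‖ₑ ^ α ∂μ with hB
  have hmeas := aemeasurable_prod_enorm_mul_sub hk hg α β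
  have hβ' : 0 ≤ β⁻¹ - γ⁻¹ := sub_nonneg.2 (inv_anti₀ hβ hβγ)
  have hα' : 0 ≤ α⁻¹ - γ⁻¹ := sub_nonneg.2 (inv_anti₀ hα hαγ)
  have hswap : ∫⁻ x, ∫⁻ t, ‖k t‖ₑ ^ β * ‖g (x - t)‖ₑ ^ α ∂μ ∂μ = A * B := by
    rw [lintegral_lintegral_swap hmeas]
    have : ∀ t, ∫⁻ x, ‖k t‖ₑ ^ β * ‖g (x - t)‖ₑ ^ α ∂μ = ‖k t‖ₑ ^ β * B := fun t => by
      have hmp := measurePreserving_sub_right μ t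
      rw [lintegral_const_mul'' (f := fun x => ‖g (x - t)‖ₑ ^ α) _
          ((hg.comp_measurePreserving hmp).enorm.pow_const α),
        lintegral_sub_right_eq_self (fun x => ‖g x‖ₑ ^ α) t]
    simp_rw [this]
    rw [lintegral_mul_const'' _ (hk.enorm.pow_const β)]
  calc ∫⁻ x, (∫⁻ t, ‖k t‖ₑ * ‖g (x - t)‖ₑ ∂μ) ^ γ ∂μ
      ≤ ∫⁻ x, (∫⁻ t, ‖k t‖ₑ ^ β * ‖g (x - t)‖ₑ ^ α ∂μ) *
          (A ^ (β⁻¹ - γ⁻¹) * B ^ (α⁻¹ - γ⁻¹)) ^ γ ∂μ := by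
        refine lintegral_mono fun x => ?_
        refine (ENNReal.rpow_le_rpow (lintegral_enorm_mul_sub_le_rpow hα hβ hγ hαγ hβγ h hk hg x)
          hγ.le).trans (le_of_eq ?_)
        rw [ENNReal.mul_rpow_of_nonneg _ _ hγ.le, ← ENNReal.rpow_mul, inv_mul_cancel₀ hγ.ne',
          ENNReal.rpow_one]
    _ = A * B * (A ^ (β⁻¹ - γ⁻¹) * B ^ (α⁻¹ - γ⁻¹)) ^ γ := by
        rw [lintegral_mul_const'' _ hmeas.lintegral_prod_right', hswap]
    _ = (A ^ β⁻¹ * B ^ α⁻¹) ^ γ := by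
        have e : ∀ (C : ℝ≥0∞) (δ : ℝ), 0 ≤ δ⁻¹ - γ⁻¹ →
            C ^ δ⁻¹ = C ^ γ⁻¹ * C ^ (δ⁻¹ - γ⁻¹) := fun C δ hδ => by
          rw [← ENNReal.rpow_add_of_nonneg _ _ (by positivity) hδ, add_sub_cancel]
        rw [e A β hβ', e B α hα']
        simp only [ENNReal.mul_rpow_of_nonneg _ _ hγ.le, ← ENNReal.rpow_mul,
          inv_mul_cancel₀ hγ.ne', ENNReal.rpow_one]
        ring

/-- **Young's convolution inequality**. -/
theorem eLpNorm_lintegral_enorm_mul_sub_le [SFinite μ] {k g : G → 𝕜} {a b c : ℝ≥0∞}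
    (ha : 1 ≤ a) (hb : 1 ≤ b) (h : a⁻¹ + b⁻¹ = 1 + c⁻¹)
    (hk : AEStronglyMeasurable k μ) (hg : AEStronglyMeasurable g μ) :
    eLpNorm (fun x => ∫⁻ t, ‖k t‖ₑ * ‖g (x - t)‖ₑ ∂μ) c μ ≤ eLpNorm k b μ * eLpNorm g a μ := by
  rcases eq_or_ne c ∞ with rfl | hc
  · have : ENNReal.HolderConjugate b a := ⟨by simpa [add_comm] using h⟩
    rw [eLpNorm_exponent_top]
    refine eLpNormEssSup_le_of_ae_enorm_bound (Filter.Eventually.of_forall fun x => ?_)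
    exact lintegral_enorm_mul_sub_le_of_holderConjugate hk hg x
  have ha1 : a⁻¹ ≤ 1 := ENNReal.inv_le_one.2 ha
  have hb1 : b⁻¹ ≤ 1 := ENNReal.inv_le_one.2 hb
  have hca : c⁻¹ ≤ a⁻¹ := by
    have : 1 + c⁻¹ ≤ 1 + a⁻¹ := by rw [← h, add_comm]; gcongr
    exact (ENNReal.add_le_add_iff_left ENNReal.one_ne_top).1 this
  have hcb : c⁻¹ ≤ b⁻¹ := by
    have : 1 + c⁻¹ ≤ 1 + b⁻¹ := by rw [← h]; gcongr
    exact (ENNReal.add_le_add_iff_left ENNReal.one_ne_top).1 this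
  have hac : a ≤ c := ENNReal.inv_le_inv.1 hca
  have hbc : b ≤ c := ENNReal.inv_le_inv.1 hcb
  have ha' : a ≠ ∞ := ne_top_of_le_ne_top hc hac
  have hb' : b ≠ ∞ := ne_top_of_le_ne_top hc hbc
  have ha0 : a ≠ 0 := (zero_lt_one.trans_le ha).ne'
  have hb0 : b ≠ 0 := (zero_lt_one.trans_le hb).ne'
  have hc0 : c ≠ 0 := (zero_lt_one.trans_le (ha.trans hac)).ne'
  have hγ := ENNReal.toReal_pos hc0 hc
  have hreal : a.toReal⁻¹ + b.toReal⁻¹ = 1 + c.toReal⁻¹ := by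
    have := congrArg ENNReal.toReal h
    rwa [ENNReal.toReal_add (by simpa) (by simpa), ENNReal.toReal_add (by simp) (by simpa),
      ENNReal.toReal_inv, ENNReal.toReal_inv, ENNReal.toReal_inv, ENNReal.toReal_one] at this
  rw [eLpNorm_eq_lintegral_rpow_enorm_toReal hc0 hc, eLpNorm_eq_lintegral_rpow_enorm_toReal ha0 ha',
    eLpNorm_eq_lintegral_rpow_enorm_toReal hb0 hb']
  simp only [one_div, enorm_eq_self]
  rw [ENNReal.rpow_inv_le_iff hγ]
  exact lintegral_rpow_lintegral_enorm_mul_sub_le (ENNReal.toReal_pos ha0 ha')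
    (ENNReal.toReal_pos hb0 hb') hγ (ENNReal.toReal_mono hc hac) (ENNReal.toReal_mono hc hbc)
    hreal hk hg

end Young

/-! ### Continuity of translation in a dual pairing. -/

section Translation

variable {E : Type*} [NormedAddCommGroup E] [SecondCountableTopology E] [LocallyCompactSpace E]
  [MeasurableSpace E] [BorelSpace E] {μ : Measure E} [μ.IsAddHaarMeasure]

theorem continuous_integral_mul_translate_of_ne_top {u v : E → ℂ} {a b : ℝ≥0∞}
    [ENNReal.HolderConjugate a b] (hb : b ≠ ∞) (hu : MemLp u a μ) (hv : MemLp v b μ) :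
    Continuous fun t => ∫ x, u x * v (x + t) ∂μ := by
  have : Fact (1 ≤ a) := ⟨ENNReal.HolderConjugate.one_le a b⟩
  have : Fact (1 ≤ b) := ⟨ENNReal.HolderConjugate.one_le b a⟩
  have : Fact (b ≠ ∞) := ⟨hb⟩
  have hcont : Continuous fun t : E => (DomAddAct.mk t) +ᵥ (hv.toLp v) :=
    continuous_vadd.comp (Continuous.prodMk DomAddAct.continuous_mk continuous_const)
  have := ((ContinuousLinearMap.mul ℂ ℂ).lpPairing μ a b (hu.toLp u)).continuous.comp hcont
  refine this.congr fun t => ?_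
  simp only [Function.comp]
  rw [ContinuousLinearMap.lpPairing_eq_integral]
  refine integral_congr_ae ?_
  have h1 := hu.coeFn_toLp
  rw [DomAddAct.mk_vadd_toLp]
  filter_upwards [h1, MemLp.coeFn_toLp (hv.comp_measurePreserving (measurePreserving_vadd t μ))]
    with x hx hx'
  rw [hx]
  refine (congrArg (fun w => u x * w) hx').trans ?_
  simp [add_comm]

theorem continuous_integral_mul_translate {u v : E → ℂ} {a b : ℝ≥0∞}
    [ENNReal.HolderConjugate a b] (hu : MemLp u a μ) (hv : MemLp v b μ) :
    Continuous fun t => ∫ x, u x * v (x + t) ∂μ := by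
  rcases eq_or_ne b ∞ with rfl | hb
  -- Translation is not continuous on `L^∞`; a change of variables moves it to `u`, whose exponent
  -- is finite.
  · have ha : a ≠ ∞ := by
      rintro rfl
      have := ENNReal.HolderConjugate.inv_add_inv_eq_one ∞ ∞
      simp at this
    have := (continuous_integral_mul_translate_of_ne_top (a := ∞) ha hv hu).comp continuous_neg
    refine this.congr fun t => ?_
    simp only [Function.comp]
    rw [← integral_add_right_eq_self _ t]
    simp [mul_comm]
  · exact continuous_integral_mul_translate_of_ne_top hb hu hv

end Translation

/-! ### Hölder at all conjugate exponents, and convolutions of `L^p` functions. -/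

section Convolution

theorem lintegral_mul_le_eLpNorm_mul_eLpNorm {α : Type*} [MeasurableSpace α] {μ : Measure α}
    {F H : α → ℝ≥0∞} {a b : ℝ≥0∞} [ENNReal.HolderConjugate a b]
    (hF : AEMeasurable F μ) (hH : AEMeasurable H μ) :
    ∫⁻ x, F x * H x ∂μ ≤ eLpNorm F a μ * eLpNorm H b μ := by
  rcases eq_or_ne a ∞ with rfl | ha
  · obtain rfl := ENNReal.HolderConjugate.unique ∞ b 1
    rw [eLpNorm_exponent_top, eLpNorm_one_eq_lintegral_enorm, ← lintegral_const_mul'' _ hH.enorm]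
    refine lintegral_mono_ae ?_
    filter_upwards [enorm_ae_le_eLpNormEssSup F μ] with x hx
    exact mul_le_mul' hx le_rfl
  rcases eq_or_ne b ∞ with rfl | hb
  · have := ENNReal.HolderConjugate.symm (p := a) (q := ∞)
    obtain rfl := ENNReal.HolderConjugate.unique ∞ a 1
    rw [eLpNorm_exponent_top, eLpNorm_one_eq_lintegral_enorm, ← lintegral_mul_const'' _ hF.enorm]
    refine lintegral_mono_ae ?_
    filter_upwards [enorm_ae_le_eLpNormEssSup H μ] with x hx
    exact mul_le_mul' le_rfl hx
  rw [eLpNorm_eq_lintegral_rpow_enorm_toReal (ENNReal.HolderConjugate.ne_zero a b) ha,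
    eLpNorm_eq_lintegral_rpow_enorm_toReal (ENNReal.HolderConjugate.ne_zero b a) hb]
  exact ENNReal.lintegral_mul_le_Lp_mul_Lq μ (ENNReal.HolderConjugate.toReal_of_ne_top ha hb) hF hH

variable {G : Type*} [AddCommGroup G] [MeasurableSpace G] [MeasurableAdd₂ G] [MeasurableNeg G]
  {μ : Measure G} [μ.IsAddLeftInvariant] [SFinite μ]

theorem aestronglyMeasurable_mul_sub {k g : G → ℂ}
    (hk : AEStronglyMeasurable k μ) (hg : AEStronglyMeasurable g μ) :
    AEStronglyMeasurable (fun z : G × G => k z.2 * g (z.1 - z.2)) (μ.prod μ) :=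
  hk.convolution_integrand (ContinuousLinearMap.mul ℝ ℂ) hg

variable [μ.IsNegInvariant]

theorem eLpNorm_integral_mul_sub_le {k g : G → ℂ} {a b c : ℝ≥0∞}
    (ha : 1 ≤ a) (hb : 1 ≤ b) (h : a⁻¹ + b⁻¹ = 1 + c⁻¹)
    (hk : AEStronglyMeasurable k μ) (hg : AEStronglyMeasurable g μ) :
    eLpNorm (fun x => ∫ t, k t * g (x - t) ∂μ) c μ ≤ eLpNorm k b μ * eLpNorm g a μ := by
  refine (eLpNorm_mono_enorm fun x => ?_).trans (eLpNorm_lintegral_enorm_mul_sub_le ha hb h hk hg)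
  refine (enorm_integral_le_lintegral_enorm _).trans (le_of_eq ?_)
  simp [enorm_mul]

theorem memLp_integral_mul_sub {k g : G → ℂ} {a b c : ℝ≥0∞}
    (ha : 1 ≤ a) (hb : 1 ≤ b) (h : a⁻¹ + b⁻¹ = 1 + c⁻¹) (hk : MemLp k b μ) (hg : MemLp g a μ) :
    MemLp (fun x => ∫ t, k t * g (x - t) ∂μ) c μ :=
  ⟨(aestronglyMeasurable_mul_sub hk.1 hg.1).integral_prod_right',
    (eLpNorm_integral_mul_sub_le ha hb h hk.1 hg.1).trans_lt (ENNReal.mul_lt_top hk.2 hg.2)⟩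

theorem integrable_prod_mul_sub_mul {k g φ : G → ℂ} {a b c d : ℝ≥0∞} [ENNReal.HolderConjugate c d]
    (ha : 1 ≤ a) (hb : 1 ≤ b) (h : a⁻¹ + b⁻¹ = 1 + c⁻¹) (hk : MemLp k b μ) (hg : MemLp g a μ)
    (hφ : MemLp φ d μ) :
    Integrable (fun z : G × G => k z.2 * g (z.1 - z.2) * φ z.1) (μ.prod μ) := by
  have hm := aestronglyMeasurable_mul_sub hk.1 hg.1
  have hm' : AEStronglyMeasurable (fun z : G × G => k z.2 * g (z.1 - z.2) * φ z.1) (μ.prod μ) :=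
    hm.mul hφ.1.comp_fst
  refine ⟨hm', ?_⟩
  rw [hasFiniteIntegral_iff_enorm, lintegral_prod _ hm'.enorm]
  have hY : AEMeasurable (fun x => ∫⁻ t, ‖k t‖ₑ * ‖g (x - t)‖ₑ ∂μ) μ := by
    simpa [enorm_mul] using hm.enorm.lintegral_prod_right'
  calc ∫⁻ x, ∫⁻ t, ‖k t * g (x - t) * φ x‖ₑ ∂μ ∂μ
      = ∫⁻ x, (∫⁻ t, ‖k t‖ₑ * ‖g (x - t)‖ₑ ∂μ) * ‖φ x‖ₑ ∂μ := by
        simp_rw [enorm_mul]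
        exact lintegral_congr fun x => lintegral_mul_const' _ _ enorm_ne_top
    _ ≤ eLpNorm (fun x => ∫⁻ t, ‖k t‖ₑ * ‖g (x - t)‖ₑ ∂μ) c μ * eLpNorm (fun x => ‖φ x‖ₑ) d μ :=
        lintegral_mul_le_eLpNorm_mul_eLpNorm hY hφ.1.enorm
    _ < ∞ := ENNReal.mul_lt_top
        ((eLpNorm_lintegral_enorm_mul_sub_le ha hb h hk.1 hg.1).trans_lt
          (ENNReal.mul_lt_top hk.2 hg.2)) (by rw [eLpNorm_enorm]; exact hφ.2)

end Convolution

/-! ### Translation, modulation and reflection under the Fourier transform. -/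

section Schwartz

variable {V : Type*} [NormedAddCommGroup V] [InnerProductSpace ℝ V] [FiniteDimensional ℝ V]
  [MeasurableSpace V] [BorelSpace V]

theorem fourier_compSubConst (φ : 𝓢(V, ℂ)) (y ξ : V) :
    𝓕 (φ.compSubConstCLM ℂ (-y)) ξ = (𝐞 (inner ℝ y ξ) : ℂ) * 𝓕 φ ξ := by
  have h := congrFun (VectorFourier.fourierIntegral_comp_add_right 𝐞 (volume : Measure V)
    (innerₗ V) φ y) ξ
  rw [SchwartzMap.fourier_coe, SchwartzMap.fourier_coe]
  refine Eq.trans ?_ (h.trans ?_)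
  · have : (φ.compSubConstCLM ℂ (-y) : V → ℂ) = φ ∘ fun v => v + y := by
      ext v; simp
    rw [this]; rfl
  · rw [Circle.smul_def, smul_eq_mul]; rfl

theorem fourierInv_compSubConst (η : 𝓢(V, ℂ)) (y ξ : V) :
    𝓕⁻ (η.compSubConstCLM ℂ ξ) y = (𝐞 (inner ℝ ξ y) : ℂ) * 𝓕⁻ η y := by
  have h := fourier_compSubConst η (-ξ) (-y)
  rw [neg_neg, inner_neg_neg] at h
  rw [SchwartzMap.fourierInv_coe, SchwartzMap.fourierInv_coe, Real.fourierInv_eq_fourier_neg,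
    Real.fourierInv_eq_fourier_neg, ← SchwartzMap.fourier_coe, ← SchwartzMap.fourier_coe, h]

theorem fourier_fourier_apply (φ : 𝓢(V, ℂ)) (x : V) : 𝓕 (𝓕 φ) x = φ (-x) := by
  have h : 𝓕⁻ (𝓕 φ) (-x) = φ (-x) := by rw [FourierTransform.fourierInv_fourier_eq]
  rwa [SchwartzMap.fourierInv_coe, Real.fourierInv_eq_fourier_neg, neg_neg,
    ← SchwartzMap.fourier_coe] at h

end Schwartz

namespace IsFourierTransformOf

variable {n : ℕ} {f g h k : EuclideanSpace ℝ (Fin n) → ℂ}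

theorem integral_mul_translate (hg : IsFourierTransformOf g f) (φ : 𝓢(EuclideanSpace ℝ (Fin n), ℂ)) (y : EuclideanSpace ℝ (Fin n)) :
    ∫ z, g z * φ (z + y) = ∫ ξ, f ξ * ((𝐞 (inner ℝ y ξ) : ℂ) * 𝓕 φ ξ) := by
  have := hg (φ.compSubConstCLM ℂ (-y))
  simp only [fourier_compSubConst] at this
  simpa using this

theorem integral_mul_modulate (hk : IsFourierTransformOf k h) (η : 𝓢(EuclideanSpace ℝ (Fin n), ℂ)) (ξ : EuclideanSpace ℝ (Fin n)) :
    ∫ y, k y * ((𝐞 (inner ℝ ξ y) : ℂ) * 𝓕⁻ η y) = ∫ x, h x * η (x - ξ) := by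
  have := hk (𝓕⁻ (η.compSubConstCLM ℂ ξ))
  rw [FourierTransform.fourier_fourierInv_eq] at this
  simpa only [fourierInv_compSubConst, SchwartzMap.compSubConstCLM_apply] using this

/-- Fourier inversion, by testing on `𝓕⁻ φ`. With `comp_neg_symm` it links the two conventions in
use: membership in `L̂^q` asks for `f = ĝ`, the norm for `g = f̂`. -/
theorem comp_neg (hg : IsFourierTransformOf g f) :
    IsFourierTransformOf f fun x => g (-x) := by
  intro φ
  have := hg (𝓕⁻ φ)
  rw [FourierTransform.fourier_fourierInv_eq] at this
  rw [← this, ← integral_neg_eq_self]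
  refine integral_congr_ae (Filter.Eventually.of_forall fun x => ?_)
  simp only
  rw [SchwartzMap.fourierInv_coe, Real.fourierInv_eq_fourier_neg, neg_neg,
    ← SchwartzMap.fourier_coe]

theorem comp_neg_symm (hg : IsFourierTransformOf f g) :
    IsFourierTransformOf (fun x => g (-x)) f := by
  intro φ
  rw [hg (𝓕 φ), ← integral_neg_eq_self]
  simp [fourier_fourier_apply]

end IsFourierTransformOf

/-! ### An approximate identity, whose inverse transforms are bounded by 1 and tend to 1. -/

section Bump

/-- A sequence of bump functions at the origin whose supports shrink to the origin. -/
def shrinkingBump (V : Type*) [NormedAddCommGroup V] [InnerProductSpace ℝ V] (j : ℕ) :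
    ContDiffBump (0 : V) where
  rIn := ((j : ℝ) + 1)⁻¹
  rOut := 2 * ((j : ℝ) + 1)⁻¹
  rIn_pos := by positivity
  rIn_lt_rOut := by
    have : 0 < ((j : ℝ) + 1)⁻¹ := by positivity
    linarith

theorem tendsto_rOut_shrinkingBump (V : Type*) [NormedAddCommGroup V] [InnerProductSpace ℝ V] :
    Filter.Tendsto (fun j => (shrinkingBump V j).rOut) Filter.atTop (nhds 0) := by
  have := (tendsto_one_div_add_atTop_nhds_zero_nat (𝕜 := ℝ)).const_mul 2
  simpa [shrinkingBump, one_div] using this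

variable {V : Type*} [NormedAddCommGroup V] [InnerProductSpace ℝ V] [FiniteDimensional ℝ V]
  [MeasurableSpace V] [BorelSpace V]

/-- The normalized bump functions as complex Schwartz functions. -/
def approxIdentity (V : Type*) [NormedAddCommGroup V] [InnerProductSpace ℝ V]
    [FiniteDimensional ℝ V] [MeasurableSpace V] [BorelSpace V] (j : ℕ) : 𝓢(V, ℂ) :=
  HasCompactSupport.toSchwartzMap
    (f := fun x => (((shrinkingBump V j).normed volume x : ℝ) : ℂ))
    ((shrinkingBump V j).hasCompactSupport_normed.comp_left Complex.ofReal_zero)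
    (Complex.ofRealCLM.contDiff.comp (shrinkingBump V j).contDiff_normed)

theorem approxIdentity_apply (j : ℕ) (x : V) :
    approxIdentity V j x = (((shrinkingBump V j).normed volume x : ℝ) : ℂ) := rfl

theorem integral_norm_approxIdentity (j : ℕ) : ∫ x, ‖approxIdentity V j x‖ = 1 := by
  rw [← (shrinkingBump V j).integral_normed (μ := volume)]
  refine integral_congr_ae (Filter.Eventually.of_forall fun x => ?_)
  simp [approxIdentity_apply, abs_of_nonneg ((shrinkingBump V j).nonneg_normed x)]

theorem tendsto_integral_approxIdentity_mul {A : V → ℂ} (hA : Continuous A) :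
    Filter.Tendsto (fun j => ∫ t, approxIdentity V j t * A t) Filter.atTop (nhds (A 0)) := by
  have h := ContDiffBump.convolution_tendsto_right_of_continuous (μ := (volume : Measure V))
    (tendsto_rOut_shrinkingBump V) (hA.comp continuous_neg) 0
  simpa [convolution, approxIdentity_apply] using h

theorem norm_fourierInv_approxIdentity_le (j : ℕ) (y : V) : ‖𝓕⁻ (approxIdentity V j) y‖ ≤ 1 := by
  rw [SchwartzMap.fourierInv_coe, Real.fourierInv_eq, ← integral_norm_approxIdentity (V := V) j]
  refine (norm_integral_le_integral_norm _).trans (le_of_eq ?_)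
  simp only [Circle.norm_smul]

theorem tendsto_fourierInv_approxIdentity (y : V) :
    Filter.Tendsto (fun j => 𝓕⁻ (approxIdentity V j) y) Filter.atTop (nhds 1) := by
  have h := tendsto_integral_approxIdentity_mul (V := V)
    (A := fun v => (𝐞 (inner ℝ v y) : ℂ)) (by fun_prop)
  simp only [inner_zero_left, AddChar.map_zero_eq_one, Circle.coe_one] at h
  refine h.congr fun j => ?_
  rw [SchwartzMap.fourierInv_coe, Real.fourierInv_eq]
  refine integral_congr_ae (Filter.Eventually.of_forall fun v => ?_)
  simp [Circle.smul_def, mul_comm]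

end Bump

/-! ### The convolution theorem for distributional Fourier transforms. -/

theorem integrable_prod_mul_translate_mul {V : Type*} [NormedAddCommGroup V]
    [InnerProductSpace ℝ V] [FiniteDimensional ℝ V] [MeasurableSpace V] [BorelSpace V]
    {u h η : V → ℂ} {a b : ℝ≥0∞} [ENNReal.HolderConjugate a b] (hu : Integrable u)
    (hh : MemLp h a) (hη : MemLp η b) :
    Integrable (fun z : V × V => u z.1 * (h (z.1 + z.2) * η z.2))
      ((volume : Measure V).prod volume) := by
  have hadd : AEStronglyMeasurable (fun z : V × V => h (z.1 + z.2))
      ((volume : Measure V).prod volume) :=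
    hh.1.comp_quasiMeasurePreserving (quasiMeasurePreserving_add volume volume)
  have hm : AEStronglyMeasurable (fun z : V × V => u z.1 * (h (z.1 + z.2) * η z.2))
      ((volume : Measure V).prod volume) :=
    hu.1.comp_fst.mul (hadd.mul hη.1.comp_snd)
  refine ⟨hm, ?_⟩
  rw [hasFiniteIntegral_iff_enorm, lintegral_prod _ hm.enorm]
  calc ∫⁻ x, ∫⁻ t, ‖u x * (h (x + t) * η t)‖ₑ
      ≤ ∫⁻ x, ‖u x‖ₑ * (eLpNorm h a volume * eLpNorm η b volume) := by
        refine lintegral_mono fun x => ?_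
        have hmp := measurePreserving_add_left (volume : Measure V) x
        simp_rw [enorm_mul]
        rw [lintegral_const_mul' _ _ enorm_ne_top]
        gcongr
        have := lintegral_mul_le_eLpNorm_mul_eLpNorm (a := a) (b := b)
          (hh.1.comp_measurePreserving hmp).enorm hη.1.enorm
        rw [eLpNorm_enorm, eLpNorm_enorm, eLpNorm_comp_measurePreserving hh.1 hmp] at this
        exact this
    _ < ∞ := by
        rw [lintegral_mul_const'' _ hu.1.enorm]
        exact ENNReal.mul_lt_top hu.2 (ENNReal.mul_lt_top hh.2 hη.2)

namespace IsFourierTransformOf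

variable {n : ℕ} {f g h k : EuclideanSpace ℝ (Fin n) → ℂ}

/-- The regularized convolution theorem. The correlation of `g` with `φ` is an integral of
characters against `f · 𝓕 φ`; after Fubini, `k` meets a modulated `𝓕⁻ η`, which turns into `h`
against a translate of `η`. The factor `𝓕⁻ η` supplies the integrability that `k` alone may lack. -/
theorem integral_mul_fourierInv_mul_translate {r r' : ℝ≥0∞} [ENNReal.HolderConjugate r r']
    (hg : IsFourierTransformOf g f) (hk : IsFourierTransformOf k h)
    (φ η : 𝓢(EuclideanSpace ℝ (Fin n), ℂ)) (hu : Integrable fun ξ => f ξ * 𝓕 φ ξ)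
    (hh : MemLp h r') (hkr : MemLp k r) :
    ∫ y, k y * (𝓕⁻ η y * ∫ z, g z * φ (z + y)) =
      ∫ t, η t * ∫ ξ, f ξ * 𝓕 φ ξ * h (ξ + t) := by
  have : ENNReal.HolderConjugate r' r := .symm
  set u : EuclideanSpace ℝ (Fin n) → ℂ := fun ξ => f ξ * 𝓕 φ ξ with hu_def
  have hkγ : Integrable fun y => k y * 𝓕⁻ η y := hkr.integrable_mul ((𝓕⁻ η).memLp r')
  have hint1 : Integrable (fun z : EuclideanSpace ℝ (Fin n) × EuclideanSpace ℝ (Fin n) =>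
      (𝐞 (inner ℝ z.1 z.2) : ℂ) * ((k z.1 * 𝓕⁻ η z.1) * u z.2))
      (volume.prod volume) := by
    refine (hkγ.mul_prod hu).bdd_mul (c := 1) ?_ ?_
    · exact (by fun_prop : Continuous fun z : EuclideanSpace ℝ (Fin n) ×
        EuclideanSpace ℝ (Fin n) => (𝐞 (inner ℝ z.1 z.2) : ℂ)).aestronglyMeasurable
    · exact Filter.Eventually.of_forall fun z => (Circle.norm_coe _).le
  have hint2 := integrable_prod_mul_translate_mul hu hh (η.memLp r)
  calc ∫ y, k y * (𝓕⁻ η y * ∫ z, g z * φ (z + y))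
      = ∫ y, ∫ ξ, (𝐞 (inner ℝ y ξ) : ℂ) * ((k y * 𝓕⁻ η y) * u ξ) := by
        refine integral_congr_ae (Filter.Eventually.of_forall fun y => ?_)
        simp only
        rw [hg.integral_mul_translate, ← mul_assoc, ← integral_const_mul]
        refine integral_congr_ae (Filter.Eventually.of_forall fun ξ => ?_)
        simp only [hu_def]
        ring
    _ = ∫ ξ, ∫ y, (𝐞 (inner ℝ y ξ) : ℂ) * ((k y * 𝓕⁻ η y) * u ξ) :=
        integral_integral_swap hint1
    _ = ∫ ξ, ∫ t, u ξ * (h (ξ + t) * η t) := by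
        refine integral_congr_ae (Filter.Eventually.of_forall fun ξ => ?_)
        simp only
        have e : ∫ y, k y * ((𝐞 (inner ℝ ξ y) : ℂ) * 𝓕⁻ η y) = ∫ t, h (ξ + t) * η t := by
          rw [hk.integral_mul_modulate η ξ,
            ← integral_add_left_eq_self (fun x => h x * η (x - ξ)) ξ]
          simp
        rw [integral_const_mul, ← e, ← integral_const_mul]
        refine integral_congr_ae (Filter.Eventually.of_forall fun y => ?_)
        beta_reduce
        rw [real_inner_comm ξ y]
        ring
    _ = ∫ t, ∫ ξ, u ξ * (h (ξ + t) * η t) := integral_integral_swap hint2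
    _ = ∫ t, η t * ∫ ξ, f ξ * 𝓕 φ ξ * h (ξ + t) := by
        refine integral_congr_ae (Filter.Eventually.of_forall fun t => ?_)
        simp only
        rw [← integral_const_mul]
        refine integral_congr_ae (Filter.Eventually.of_forall fun ξ => ?_)
        simp only [hu_def]
        ring

/-- The convolution of the Fourier transforms of `h` and `f` is the Fourier transform of `f h`. -/
theorem convolution_mul {a b p p' q r' : ℝ≥0∞}
    [ENNReal.HolderConjugate a q] [ENNReal.HolderConjugate b r'] [ENNReal.HolderConjugate p p']
    [ENNReal.HolderTriple q p b] (hab : a⁻¹ + b⁻¹ = 1 + p⁻¹)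
    (hg : IsFourierTransformOf g f) (hk : IsFourierTransformOf k h)
    (hfq : MemLp f q) (hga : MemLp g a) (hhr : MemLp h r') (hkb : MemLp k b) :
    IsFourierTransformOf (fun x => ∫ t, k t * g (x - t)) (fun x => h x * f x) := by
  intro φ
  have : ENNReal.HolderConjugate q a := .symm
  have ha : 1 ≤ a := ENNReal.HolderConjugate.one_le a q
  have hb : 1 ≤ b := ENNReal.HolderConjugate.one_le b r'
  have hu : Integrable fun ξ => f ξ * 𝓕 φ ξ := hfq.integrable_mul ((𝓕 φ).memLp a)
  -- Exponent `b`, conjugate to that of `h`, is what makes the pairing with translates of `h`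
  -- continuous in `hlim2`.
  have hub : MemLp (fun ξ => f ξ * 𝓕 φ ξ) b := MemLp.mul' ((𝓕 φ).memLp p) hfq
  have hint := integrable_prod_mul_sub_mul (c := p) (d := p') ha hb hab hkb hga (φ.memLp p')
  have hΦ : ∀ t, ∫ x, k t * g (x - t) * φ x = k t * ∫ z, g z * φ (z + t) := fun t => by
    rw [← integral_add_right_eq_self _ t, ← integral_const_mul]
    simp [mul_assoc]
  have hkΦ : Integrable fun t => k t * ∫ z, g z * φ (z + t) := by
    simpa only [hΦ] using hint.integral_prod_right
  have hfub : ∫ x, (∫ t, k t * g (x - t)) * φ x = ∫ t, k t * ∫ z, g z * φ (z + t) := by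
    simp_rw [← integral_mul_const, ← hΦ]
    exact integral_integral_swap hint
  have hlim1 : Filter.Tendsto
      (fun j => ∫ t, k t * (𝓕⁻ (approxIdentity (EuclideanSpace ℝ (Fin n)) j) t *
        ∫ z, g z * φ (z + t))) Filter.atTop (nhds (∫ t, k t * ∫ z, g z * φ (z + t))) := by
    refine tendsto_integral_of_dominated_convergence
      (fun t => ‖k t * ∫ z, g z * φ (z + t)‖) (fun j => ?_) hkΦ.norm (fun j => ?_) ?_
    · refine ((𝓕⁻ (approxIdentity (EuclideanSpace ℝ (Fin n)) j)).continuous.aestronglyMeasurable.mul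
        hkΦ.1).congr (Filter.Eventually.of_forall fun t => ?_)
      simp only [Pi.mul_apply]
      ring
    · refine Filter.Eventually.of_forall fun t => ?_
      rw [mul_left_comm, norm_mul]
      exact mul_le_of_le_one_left (norm_nonneg _) (norm_fourierInv_approxIdentity_le j t)
    · refine Filter.Eventually.of_forall fun t => ?_
      have := (tendsto_fourierInv_approxIdentity t).mul_const (k t * ∫ z, g z * φ (z + t))
      rw [one_mul] at this
      exact this.congr fun j => by ring
  have hlim2 := tendsto_integral_approxIdentity_mul
    (continuous_integral_mul_translate (a := b) (b := r') hub hhr)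
  -- The regularized identity equates the two sequences; the second limit is the pairing at
  -- translation `t = 0`.
  have heq := tendsto_nhds_unique hlim1 (hlim2.congr fun j =>
    (hg.integral_mul_fourierInv_mul_translate hk φ _ hu hhr hkb).symm)
  rw [hfub, heq]
  simp only [add_zero]
  exact integral_congr_ae (Filter.Eventually.of_forall fun x => by simp only; ring)

end IsFourierTransformOf

/-! ### Integration against `fμ`, and elementary properties of the norm on `L̂^q`. -/

variable {n : ℕ}

theorem conjExponent_conjExponent {p : ℝ≥0∞} (hp : 1 ≤ p) :
    ENNReal.conjExponent (ENNReal.conjExponent p) = p := by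
  have : ENNReal.HolderConjugate p (ENNReal.conjExponent p) := .conjExponent hp
  have : ENNReal.HolderConjugate (ENNReal.conjExponent p) p := .symm
  exact ENNReal.HolderConjugate.conjExponent_eq

namespace SigmaFiniteComplexMeasure

theorem integrable_mulFun_iff (μ : SigmaFiniteComplexMeasure n)
    {f h : EuclideanSpace ℝ (Fin n) → ℂ} (hf : Measurable f) (hh : Measurable h) :
    (μ.mulFun f hf).Integrable h ↔ μ.Integrable fun x => h x * f x := by
  unfold Integrable mulFun
  simp only
  rw [integrable_withDensity_iff_integrable_smul hf.nnnorm, ← integrable_norm_iff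
    (f := fun x => ‖f x‖₊ • h x) (hf.nnnorm.smul hh).aestronglyMeasurable,
    ← integrable_norm_iff (f := fun x => h x * f x) (hh.mul hf).aestronglyMeasurable]
  simp [NNReal.smul_def, mul_comm]

theorem integral_mulFun (μ : SigmaFiniteComplexMeasure n)
    {f : EuclideanSpace ℝ (Fin n) → ℂ} (hf : Measurable f)
    (h : EuclideanSpace ℝ (Fin n) → ℂ) :
    (μ.mulFun f hf).integral h = μ.integral fun x => h x * f x := by
  unfold integral mulFun
  simp only
  rw [integral_withDensity_eq_integral_smul hf.nnnorm]
  refine integral_congr_ae (Filter.Eventually.of_forall fun x => ?_)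
  -- Where `f` vanishes its phase is the default value 1, which the zero density makes harmless.
  by_cases h0 : f x = 0
  · simp [h0]
  · have h' : (‖f x‖ : ℂ) ≠ 0 := by simpa using h0
    simp only [h0, if_false, NNReal.smul_def, coe_nnnorm, Complex.real_smul]
    field_simp

end SigmaFiniteComplexMeasure

theorem IsFourierTransformOf.const_mul {f g : EuclideanSpace ℝ (Fin n) → ℂ}
    (h : IsFourierTransformOf f g) (c : ℂ) :
    IsFourierTransformOf (fun x => c * f x) fun x => c * g x := fun φ => by
  simp only [mul_assoc, integral_const_mul, h φ]

theorem exists_of_hatNorm_lt {q a : ℝ≥0∞} {f : EuclideanSpace ℝ (Fin n) → ℂ}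
    (h : hatNorm q f < a) :
    ∃ g, MemLp g (ENNReal.conjExponent q) volume ∧ IsFourierTransformOf g f ∧
      eLpNorm g (ENNReal.conjExponent q) volume < a := by
  obtain ⟨g, hg⟩ := iInf_lt_iff.1 h
  obtain ⟨hg, hlt⟩ := iInf_lt_iff.1 hg
  exact ⟨g, hg.1, hg.2, hlt⟩

theorem hatNorm_le {q : ℝ≥0∞} {f g : EuclideanSpace ℝ (Fin n) → ℂ}
    (hg : MemLp g (ENNReal.conjExponent q) volume) (hgf : IsFourierTransformOf g f) :
    hatNorm q f ≤ eLpNorm g (ENNReal.conjExponent q) volume :=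
  iInf₂_le (α := ℝ≥0∞) g ⟨hg, hgf⟩

theorem hatNorm_const_mul_le (q : ℝ≥0∞) (f : EuclideanSpace ℝ (Fin n) → ℂ) {c : ℂ} (hc : c ≠ 0) :
    hatNorm q (fun x => c * f x) ≤ ‖c‖ₑ * hatNorm q f := by
  unfold hatNorm
  rw [ENNReal.mul_iInf_of_ne (enorm_ne_zero.2 hc) enorm_ne_top]
  refine le_iInf fun g => ?_
  rw [ENNReal.mul_iInf_of_ne (enorm_ne_zero.2 hc) enorm_ne_top]
  refine le_iInf fun hg => ?_
  refine (hatNorm_le (hg.1.const_mul c) (hg.2.const_mul c)).trans (le_of_eq ?_)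
  exact eLpNorm_const_smul c g _ _

/-! ### Products in `L̂^q` and the duality estimate. -/

namespace MemHatL

variable {S : Set (EuclideanSpace ℝ (Fin n))} {f h : EuclideanSpace ℝ (Fin n) → ℂ}

theorem const_mul {q : ℝ≥0∞} (hf : MemHatL S q f) (c : ℂ) : MemHatL S q fun x => c * f x where
  measurable := hf.measurable.const_mul c
  memLp := hf.memLp.const_mul c
  exists_fourier := by
    obtain ⟨g, hg, hfg⟩ := hf.exists_fourier
    exact ⟨_, hg.const_mul c, hfg.const_mul c⟩
  continuousAt x hx := continuousAt_const.mul (hf.continuousAt x hx)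

theorem hatNorm_lt_top {q : ℝ≥0∞} (hf : MemHatL S q f) : hatNorm q f < ∞ := by
  obtain ⟨g, hg, hfg⟩ := hf.exists_fourier
  have hg' : MemLp (fun x => g (-x)) (ENNReal.conjExponent q) volume :=
    hg.comp_measurePreserving (Measure.measurePreserving_neg volume)
  exact (hatNorm_le hg' hfg.comp_neg_symm).trans_lt hg'.2

section Mul

variable {p q r : ℝ≥0∞}

theorem isFourierTransformOf_mul (hp : 1 ≤ p) (hq : 1 ≤ q) (hr : 1 ≤ r)
    (hpqr : r⁻¹ = q⁻¹ + p⁻¹) (hf : MemHatL S q f) (hh : MemHatL S (ENNReal.conjExponent r) h)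
    {g k : EuclideanSpace ℝ (Fin n) → ℂ}
    (hg : MemLp g (ENNReal.conjExponent q) volume) (hgf : IsFourierTransformOf g f)
    (hk : MemLp k r volume) (hkh : IsFourierTransformOf k h) :
    MemLp (fun x => ∫ t, k t * g (x - t)) p volume ∧
      IsFourierTransformOf (fun x => ∫ t, k t * g (x - t)) (fun x => h x * f x) ∧
      eLpNorm (fun x => ∫ t, k t * g (x - t)) p volume ≤
        eLpNorm k r volume * eLpNorm g (ENNReal.conjExponent q) volume := by
  have : ENNReal.HolderConjugate p (ENNReal.conjExponent p) := .conjExponent hp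
  have : ENNReal.HolderConjugate q (ENNReal.conjExponent q) := .conjExponent hq
  have : ENNReal.HolderConjugate (ENNReal.conjExponent q) q := .symm
  have : ENNReal.HolderConjugate r (ENNReal.conjExponent r) := .conjExponent hr
  have : ENNReal.HolderTriple q p r := ⟨hpqr.symm⟩
  have hab : (ENNReal.conjExponent q)⁻¹ + r⁻¹ = 1 + p⁻¹ := by
    rw [hpqr, ← add_assoc, ENNReal.HolderConjugate.inv_add_inv_eq_one]
  have hq' : 1 ≤ ENNReal.conjExponent q := ENNReal.HolderConjugate.one_le _ q
  exact ⟨memLp_integral_mul_sub hq' hr hab hk hg,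
    hgf.convolution_mul (p' := ENNReal.conjExponent p) hab hkh hf.memLp hg hh.memLp hk,
    eLpNorm_integral_mul_sub_le hq' hr hab hk.1 hg.1⟩

theorem hatNorm_mul_le (hp : 1 ≤ p) (hq : 1 ≤ q) (hr : 1 ≤ r)
    (hpqr : r⁻¹ = q⁻¹ + p⁻¹) (hf : MemHatL S q f) (hh : MemHatL S (ENNReal.conjExponent r) h) :
    hatNorm (ENNReal.conjExponent p) (fun x => h x * f x) ≤
      hatNorm q f * hatNorm (ENNReal.conjExponent r) h := by
  -- Near-optimal transforms suffice, so uniqueness of `f̂` is not needed; finiteness of both norms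
  -- rules out `0 · ∞`.
  refine ENNReal.le_mul_of_forall_lt (.inr hh.hatNorm_lt_top.ne) (.inl hf.hatNorm_lt_top.ne)
    fun a ha b hb => ?_
  obtain ⟨g, hg, hgf, hga⟩ := exists_of_hatNorm_lt ha
  obtain ⟨k, hk, hkh, hkb⟩ := exists_of_hatNorm_lt hb
  rw [conjExponent_conjExponent hr] at hk hkb
  obtain ⟨h1, h2, h3⟩ := isFourierTransformOf_mul hp hq hr hpqr hf hh hg hgf hk hkh
  rw [← conjExponent_conjExponent hp] at h1 h3
  refine (hatNorm_le h1 h2).trans (h3.trans ?_)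
  rw [mul_comm]
  exact mul_le_mul' hga.le hkb.le

theorem mul (hp : 1 ≤ p) (hq : 1 ≤ q) (hr : 1 ≤ r)
    (hpqr : r⁻¹ = q⁻¹ + p⁻¹) (hf : MemHatL S q f) (hh : MemHatL S (ENNReal.conjExponent r) h) :
    MemHatL S (ENNReal.conjExponent p) fun x => h x * f x := by
  have : ENNReal.HolderConjugate p (ENNReal.conjExponent p) := .conjExponent hp
  have : ENNReal.HolderConjugate r (ENNReal.conjExponent r) := .conjExponent hr
  have hinv : (ENNReal.conjExponent r)⁻¹ + q⁻¹ = (ENNReal.conjExponent p)⁻¹ := by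
    have h1 := ENNReal.HolderConjugate.inv_add_inv_eq_one p (ENNReal.conjExponent p)
    rw [← ENNReal.HolderConjugate.inv_add_inv_eq_one r (ENNReal.conjExponent r), hpqr,
      add_comm q⁻¹, add_assoc] at h1
    have hp0 : p⁻¹ ≠ ∞ := by simpa using (zero_lt_one.trans_le hp).ne'
    rw [add_comm]
    exact ((ENNReal.add_right_inj hp0).1 h1).symm
  have : ENNReal.HolderTriple (ENNReal.conjExponent r) q (ENNReal.conjExponent p) := ⟨hinv⟩
  refine ⟨hh.measurable.mul hf.measurable, hf.memLp.mul' hh.memLp, ?_, fun x hx => ?_⟩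
  · obtain ⟨g, hg, hgf, -⟩ := exists_of_hatNorm_lt hf.hatNorm_lt_top
    obtain ⟨k, hk, hkh, -⟩ := exists_of_hatNorm_lt hh.hatNorm_lt_top
    rw [conjExponent_conjExponent hr] at hk
    obtain ⟨h1, h2, -⟩ := isFourierTransformOf_mul hp hq hr hpqr hf hh hg hgf hk hkh
    rw [conjExponent_conjExponent hp]
    exact ⟨_, h1.comp_measurePreserving (Measure.measurePreserving_neg volume), h2.comp_neg⟩
  · rcases hx with hx | hx
    · exact (hh.continuousAt x (.inl hx)).mul (hf.continuousAt x (.inl hx))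
    -- If `p' = ∞`, then `1/r' + 1/q = 0` forces `r' = q = ∞`, so both factors are continuous
    -- everywhere.
    · rw [hx, ENNReal.inv_top, add_eq_zero, ENNReal.inv_eq_zero, ENNReal.inv_eq_zero] at hinv
      exact (hh.continuousAt x (.inr hinv.1)).mul (hf.continuousAt x (.inr hinv.2))

end Mul

/-- Homogeneity reduces to the unit ball, where a non-integrable test function would make the
supremum infinite. -/
theorem integrable_and_enorm_integral_le {p : ℝ≥0∞} {μ : SigmaFiniteComplexMeasure n}
    (hμ : μ ∈ spaceM S p) (hf : MemHatL S (ENNReal.conjExponent p) f) :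
    μ.Integrable f ∧
      ‖μ.integral f‖ₑ ≤ hatNorm (ENNReal.conjExponent p) f * starNorm S p μ := by
  have hμ' : starNorm S p μ < ∞ := hμ
  have key : ∀ c : ℂ, c ≠ 0 → ‖c‖ₑ * hatNorm (ENNReal.conjExponent p) f ≤ 1 →
      μ.Integrable f ∧ ‖c‖ₑ * ‖μ.integral f‖ₑ ≤ starNorm S p μ := by
    intro c hc hle
    have hsup := le_iSup₂_of_le (f := fun (h : EuclideanSpace ℝ (Fin n) → ℂ)
      (_ : MemHatL S (ENNReal.conjExponent p) h ∧ hatNorm (ENNReal.conjExponent p) h ≤ 1) =>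
        open Classical in if μ.Integrable h then ‖μ.integral h‖ₑ else ∞)
      (fun x => c * f x) ⟨hf.const_mul c, (hatNorm_const_mul_le _ f hc).trans hle⟩ le_rfl
    change _ ≤ starNorm S p μ at hsup
    by_cases hi : μ.Integrable fun x => c * f x
    · rw [if_pos hi] at hsup
      refine ⟨(integrable_const_mul_iff hc.isUnit f).1 hi, ?_⟩
      rw [← enorm_mul]
      have e : μ.integral (fun x => c * f x) = c * μ.integral f := by
        simp only [SigmaFiniteComplexMeasure.integral, mul_assoc, integral_const_mul]
      rwa [e] at hsup
    · rw [if_neg hi] at hsup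
      exact absurd (hsup.trans_lt hμ') (lt_irrefl _)
  -- The norm of `f` may be 0, so `f` is divided by any finite `s` above it, and `s` is lowered to
  -- the norm at the end.
  have key' : ∀ s : ℝ≥0∞, hatNorm (ENNReal.conjExponent p) f < s → s ≠ ∞ →
      μ.Integrable f ∧ ‖μ.integral f‖ₑ ≤ s * starNorm S p μ := by
    intro s hs hs'
    have hs0 : s ≠ 0 := (bot_le.trans_lt hs).ne'
    have hpos : 0 < s.toReal := ENNReal.toReal_pos hs0 hs'
    have hc : ‖((s.toReal⁻¹ : ℝ) : ℂ)‖ₑ = s⁻¹ := by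
      rw [← ofReal_norm, Complex.norm_real, Real.norm_of_nonneg (by positivity),
        ENNReal.ofReal_inv_of_pos hpos, ENNReal.ofReal_toReal hs']
    have := key ((s.toReal⁻¹ : ℝ) : ℂ) (by exact_mod_cast (inv_pos.2 hpos).ne') (by
      rw [hc, mul_comm, ← div_eq_mul_inv]
      exact ENNReal.div_le_of_le_mul (by rw [one_mul]; exact hs.le))
    rw [hc, mul_comm, ← div_eq_mul_inv] at this
    refine ⟨this.1, ?_⟩
    rw [mul_comm]
    exact (ENNReal.div_le_iff hs0 hs').1 this.2
  have hfin := hf.hatNorm_lt_top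
  obtain ⟨s, hs, hs'⟩ := exists_between hfin
  refine ⟨(key' s hs hs'.ne).1, ?_⟩
  refine ENNReal.le_mul_of_forall_lt (.inr hμ'.ne) (.inl hfin.ne) fun a ha b hb => ?_
  rcases eq_or_ne a ∞ with rfl | ha'
  · rw [ENNReal.top_mul (bot_le.trans_lt hb).ne']
    exact le_top
  · exact (key' a ha ha').2.trans (mul_le_mul' le_rfl hb.le)

end MemHatL

end MeasureLp
end

theorem mainTheorem4 (n : ℕ) (S : Set (EuclideanSpace ℝ (Fin n))) (p q r : ℝ≥0∞)
    (hp : 1 ≤ p) (hq : 1 ≤ q) (hr : 1 ≤ r) (hpqr : r⁻¹ = q⁻¹ + p⁻¹)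
    (μ : MeasureLp.SigmaFiniteComplexMeasure n) (hμ : μ ∈ MeasureLp.spaceM S p)
    (f : EuclideanSpace ℝ (Fin n) → ℂ) (hf : MeasureLp.MemHatL S q f) :
    MeasureLp.starNorm S r (μ.mulFun f hf.measurable) ≤
      MeasureLp.hatNorm q f * MeasureLp.starNorm S p μ := by
  refine iSup₂_le fun h hh => ?_
  obtain ⟨hh, hle⟩ := hh
  have hint := (hf.mul hp hq hr hpqr hh).integrable_and_enorm_integral_le hμ
  rw [if_pos ((μ.integrable_mulFun_iff hf.measurable hh.measurable).2 hint.1),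
    μ.integral_mulFun hf.measurable h]
  refine hint.2.trans (mul_le_mul' ?_ le_rfl)
  calc MeasureLp.hatNorm (ENNReal.conjExponent p) (fun x => h x * f x)
      ≤ MeasureLp.hatNorm q f * MeasureLp.hatNorm (ENNReal.conjExponent r) h :=
        MeasureLp.MemHatL.hatNorm_mul_le hp hq hr hpqr hf hh
    _ ≤ MeasureLp.hatNorm q f * 1 := mul_le_mul' le_rfl hle
    _ = MeasureLp.hatNorm q f := mul_one _
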